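/- Let $p$ be a prime with $p\equiv 1\pmod 4$, let $\zeta=e^{2\pi i/p}$, and let $a,b$ be integers with Legendre symbol $\left(\frac{ab}{p}\right)=-1$. For an integer $c$ put $\delta(c,p)=1$ if $c^{(p-1)/4}\equiv \frac{p-1}{2}!\pmod p$, and $\delta(c,p)=-1$ otherwise. Then $$\prod_{1\le j<k\le (p-1)/2}\left(\zeta^{aj^2}-\zeta^{ak^2}\right)\left(\zeta^{bj^2}-\zeta^{bk^2}\right)=-\delta(ab,p)\,p^{(p-3)/4}$$ and $$\prod_{1\le j<k\le (p-1)/2}\left(\cot\pi\frac{aj^2}{p}-\cot\pi\frac{ak^2}{p}\right)\left(\cot\pi\frac{bj^2}{p}-\cot\pi\frac{bk^2}{p}\right)=\delta(ab,p)\,(-1)^{(p+3)/4}\left(\frac{2^{p-1}}{p}\right)^{(p-3)/4}.$$ -/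

import Mathlib

/-- The sign `δ(c, p)`: it is `1` if `c ^ ((p - 1) / 4) ≡ ((p - 1) / 2)! (mod p)`, and `-1`
otherwise. It is used for primes `p ≡ 1 (mod 4)`, where both divisions are exact. -/
def sunDelta (c : ℤ) (p : ℕ) : ℤ :=
  if c ^ ((p - 1) / 4) ≡ (((p - 1) / 2).factorial : ℤ) [ZMOD (p : ℤ)] then 1 else -1

/-!
Put `n = (p - 1) / 2`, `m = (p - 1) / 4`, `ζ = e^{2πi/p}`, and let `Q` be the product of the
`(ζ^{aj²} - ζ^{ak²})(ζ^{bj²} - ζ^{bk²})` over `1 ≤ j < k ≤ n`.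

*Absolute value.* `Q²` is the same product over ordered pairs `j ≠ k`. The squares `j²` run through
the group `S` of nonzero squares, so the pairs are `(x, x t)` with `t ∈ S`, `t ≠ 1`, and `x` in `a S`
or in `b S`. As `a b` is a non-residue, these two cosets together are all nonzero residues. For fixed
`t` the product of the `ζ^x - ζ^{xt}` over `x ≠ 0` is `p`, whence `Q² = p^{n-1}` (`sqDiffProd_sq`)
and `Q = ε p^{m-1} √p` with `ε = ±1`.

*Sign.* Every factor in sight is a power of `1 - ζ` times an element of `ℤ[ζ]` with known residue in
`ℤ[ζ] / (1 - ζ) ≅ ZMod p` (`HasLeadingCoeff`): `1 - ζ^x` has residue `x`. Thus `p = ∏ (1 - ζ^k)` has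
residue `(p - 1)! = -1`, and `√p = ∏_{k ≤ n} (ζ^{-k/2} - ζ^{k/2})`, where the sign is fixed by
positivity of sines (`prod_stdAddChar_half_eq_sqrt`), has residue `n!`. For `Q` the residue is
`(a b)^{n(n-1)/2} ∏ (k² - j²)²`; the last product is essentially the discriminant of `X^n - 1`
modulo `p` and equals `-1` (`prod_sq_sub_sq`). Comparing, `-(a b)^m = ε n!` in `ZMod p`, so
`ε = -δ(a b, p)` (`sqDiffProd_eq`).

*Cotangents.* `cot (π x / p) = i (1 + 2 / (ζ^x - 1))`, so a difference of cotangents is a difference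
of powers of `ζ` over `(1 - ζ^x)(1 - ζ^y)`, and the denominators multiply to `p^{n-1}`
(`ofReal_cotDiffProd`).
-/

open Finset

/-! ### Products over pairs of indices -/

/-- Pairing `(j, k)` with `(k, j)`: a symmetrised product over `j < k` is the product over all
`j ≠ k`. -/
theorem prod_triangle_symm {M : Type*} [CommMonoid M] (n : ℕ) (G : ℕ → ℕ → M) :
    ∏ j ∈ Icc 1 n, ∏ k ∈ Ioc j n, G j k * G k j =
      ∏ j ∈ Icc 1 n, ∏ k ∈ (Icc 1 n).erase j, G j k := by
  have hlt : ∏ j ∈ Icc 1 n, ∏ k ∈ Ioc j n, G k j =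
      ∏ k ∈ Icc 1 n, ∏ j ∈ Ico 1 k, G k j := by
    apply Finset.prod_comm'
    intro x y
    simp only [mem_Icc, mem_Ioc, mem_Ico]
    omega
  simp only [Finset.prod_mul_distrib]
  rw [hlt, ← Finset.prod_mul_distrib]
  refine Finset.prod_congr rfl fun j hj => ?_
  rw [← Finset.prod_union]
  · refine Finset.prod_congr ?_ fun _ _ => rfl
    ext k
    simp only [mem_union, mem_Ioc, mem_Ico, mem_erase, mem_Icc] at hj ⊢
    omega
  · rw [Finset.disjoint_left]
    intro k
    simp only [mem_Ioc, mem_Ico]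
    omega

theorem prod_triangle_const {M : Type*} [CommMonoid M] (n : ℕ) (c : M) :
    ∏ j ∈ Icc 1 n, ∏ _k ∈ Ioc j n, c = c ^ (n * (n - 1) / 2) := by
  simp only [Finset.prod_const, Nat.card_Ioc]
  rw [Finset.prod_pow_eq_pow_sum, ← Finset.sum_range_id, ← Finset.sum_range_reflect]
  congr 1
  refine Finset.sum_nbij' (fun j => j - 1) (fun j => j + 1) ?_ ?_ ?_ ?_ ?_ <;>
    simp only [mem_Icc, mem_range] <;> omega

theorem prod_Icc_two_mul {M : Type*} [CommMonoid M] (n : ℕ) (F : ℕ → M) :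
    ∏ k ∈ Icc 1 (2 * n), F k = ∏ k ∈ Icc 1 n, F k * F (2 * n + 1 - k) := by
  have h : ∏ k ∈ Icc 1 n, F (2 * n + 1 - k) = ∏ k ∈ Icc (n + 1) (2 * n), F k := by
    refine Finset.prod_nbij' (fun j => 2 * n + 1 - j) (fun j => 2 * n + 1 - j) ?_ ?_ ?_ ?_ ?_ <;>
      simp only [mem_Icc, implies_true] <;> omega
  rw [Finset.prod_mul_distrib, h, ← Finset.prod_union]
  · refine Finset.prod_congr ?_ fun _ _ => rfl
    ext k
    simp only [mem_union, mem_Icc]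
    omega
  · rw [Finset.disjoint_left]
    intro k
    simp only [mem_Icc]
    omega

theorem prod_Icc_natCast {R : Type*} [CommSemiring R] (n : ℕ) :
    ∏ k ∈ Icc 1 n, (k : R) = (n.factorial : R) := by
  induction n with
  | zero => simp
  | succ n ih =>
    rw [Finset.prod_Icc_succ_top (by omega), ih, Nat.factorial_succ, Nat.cast_mul, mul_comm]

/-! ### The nonzero squares modulo `p` -/

/-- The nonzero squares modulo `p`. -/
def nonzeroSquares (p : ℕ) [Fact p.Prime] : Finset (ZMod p) :=
  univ.filter fun s => quadraticChar (ZMod p) s = 1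

section Squares

variable {p : ℕ} [Fact p.Prime]

theorem mem_nonzeroSquares {s : ZMod p} :
    s ∈ nonzeroSquares p ↔ quadraticChar (ZMod p) s = 1 := by
  simp [nonzeroSquares]

theorem ne_zero_of_mem_nonzeroSquares {s : ZMod p} (h : s ∈ nonzeroSquares p) : s ≠ 0 := by
  rintro rfl
  simp [mem_nonzeroSquares] at h

theorem one_mem_nonzeroSquares : (1 : ZMod p) ∈ nonzeroSquares p := by
  simp [mem_nonzeroSquares]

theorem mul_mem_nonzeroSquares {s t : ZMod p} (hs : s ∈ nonzeroSquares p)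
    (ht : t ∈ nonzeroSquares p) : s * t ∈ nonzeroSquares p := by
  rw [mem_nonzeroSquares] at *
  rw [map_mul, hs, ht, one_mul]

theorem inv_mem_nonzeroSquares {s : ZMod p} (hs : s ∈ nonzeroSquares p) :
    s⁻¹ ∈ nonzeroSquares p := by
  have h : quadraticChar (ZMod p) (s * s⁻¹) = 1 := by
    rw [mul_inv_cancel₀ (ne_zero_of_mem_nonzeroSquares hs), map_one]
  rw [mem_nonzeroSquares] at *
  rwa [map_mul, hs, one_mul] at h

theorem natCast_ne_zero_of_lt {k : ℕ} (h0 : 1 ≤ k) (hk : k < p) : (k : ZMod p) ≠ 0 := by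
  rw [Ne, ZMod.natCast_eq_zero_iff]
  exact fun h => absurd (Nat.le_of_dvd h0 h) (by omega)

theorem natCast_sq_inj {n j k : ℕ} (hp : p = 2 * n + 1) (hj : j ∈ Icc 1 n) (hk : k ∈ Icc 1 n)
    (h : (j : ZMod p) ^ 2 = (k : ZMod p) ^ 2) : j = k := by
  rw [mem_Icc] at hj hk
  rcases sq_eq_sq_iff_eq_or_eq_neg.mp h with h | h
  · have := (ZMod.natCast_eq_natCast_iff' j k p).mp h
    rwa [Nat.mod_eq_of_lt (by omega), Nat.mod_eq_of_lt (by omega)] at this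
  · have h' : ((j + k : ℕ) : ZMod p) = 0 := by push_cast; rw [h]; ring
    exact absurd h' (natCast_ne_zero_of_lt (by omega) (by omega))

/-- The squares `1², …, n²` run once through the nonzero squares modulo `p = 2 n + 1`. -/
theorem prod_natCast_sq {M : Type*} [CommMonoid M] {n : ℕ} (hp : p = 2 * n + 1)
    (F : ZMod p → M) :
    ∏ j ∈ Icc 1 n, F ((j : ZMod p) ^ 2) = ∏ s ∈ nonzeroSquares p, F s := by
  refine Finset.prod_nbij (fun j : ℕ => (j : ZMod p) ^ 2) ?_ ?_ ?_ ?_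
  · intro j hj
    rw [mem_Icc] at hj
    exact mem_nonzeroSquares.mpr
      (quadraticChar_sq_one' (natCast_ne_zero_of_lt hj.1 (by omega)))
  · intro j hj k hk h
    exact natCast_sq_inj hp hj hk h
  · intro s hs
    have hs0 := ne_zero_of_mem_nonzeroSquares hs
    obtain ⟨y, rfl⟩ := (quadraticChar_one_iff_isSquare hs0).mp (mem_nonzeroSquares.mp hs)
    refine ⟨y.valMinAbs.natAbs, ?_, ?_⟩
    · rw [mem_coe, mem_Icc]
      have h1 := ZMod.natAbs_valMinAbs_le y
      have h2 : y.valMinAbs.natAbs ≠ 0 := by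
        rw [Ne, Int.natAbs_eq_zero, ZMod.valMinAbs_eq_zero]
        rintro rfl
        simp at hs0
      omega
    · simp only [ZMod.natCast_natAbs_valMinAbs]
      split_ifs <;> ring
  · intro _ _
    rfl

theorem card_nonzeroSquares {n : ℕ} (hp : p = 2 * n + 1) : #(nonzeroSquares p) = n := by
  have h := prod_natCast_sq (M := Multiplicative ℕ) hp fun _ => Multiplicative.ofAdd 1
  simp only [Finset.prod_const, Nat.card_Icc] at h
  simpa [← ofAdd_nsmul] using h.symm

theorem prod_nonzeroSquares_mul {M : Type*} [CommMonoid M] {s : ZMod p}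
    (hs : s ∈ nonzeroSquares p) (F : ZMod p → M) :
    ∏ t ∈ nonzeroSquares p, F t = ∏ t ∈ nonzeroSquares p, F (s * t) := by
  have hs0 := ne_zero_of_mem_nonzeroSquares hs
  refine Finset.prod_nbij' (fun t => s⁻¹ * t) (fun t => s * t) ?_ ?_ ?_ ?_ ?_
  · exact fun t ht => mul_mem_nonzeroSquares (inv_mem_nonzeroSquares hs) ht
  · exact fun t ht => mul_mem_nonzeroSquares hs ht
  · exact fun t _ => mul_inv_cancel_left₀ hs0 t
  · exact fun t _ => inv_mul_cancel_left₀ hs0 t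
  · intro t _
    rw [mul_inv_cancel_left₀ hs0 t]

/-- A product over pairs of distinct nonzero squares, reorganised by the ratio of the pair. -/
theorem prod_offDiag_sq {M : Type*} [CommMonoid M] {n : ℕ} (hp : p = 2 * n + 1)
    (F : ZMod p → ZMod p → M) :
    ∏ j ∈ Icc 1 n, ∏ k ∈ (Icc 1 n).erase j, F ((j : ZMod p) ^ 2) ((k : ZMod p) ^ 2) =
      ∏ t ∈ (nonzeroSquares p).erase 1, ∏ s ∈ nonzeroSquares p, F s (s * t) := by
  have key : ∀ j ∈ Icc 1 n,
      ∏ k ∈ (Icc 1 n).erase j, F ((j : ZMod p) ^ 2) ((k : ZMod p) ^ 2) =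
        ∏ t ∈ (nonzeroSquares p).erase 1, F ((j : ZMod p) ^ 2) ((j : ZMod p) ^ 2 * t) := by
    intro j hj
    have hj' : (j : ZMod p) ^ 2 ∈ nonzeroSquares p := by
      rw [mem_Icc] at hj
      exact mem_nonzeroSquares.mpr
        (quadraticChar_sq_one' (natCast_ne_zero_of_lt hj.1 (by omega)))
    -- The excluded indices `k = j` and `t = 1` are filled in by the value `1`.
    have h := prod_natCast_sq hp fun s =>
      if s = (j : ZMod p) ^ 2 then 1 else F ((j : ZMod p) ^ 2) s
    rw [prod_nonzeroSquares_mul hj'] at h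
    rw [← Finset.prod_erase (Icc 1 n) (a := j) (by simp),
      ← Finset.prod_erase (nonzeroSquares p) (a := 1) (by simp)] at h
    convert h using 1
    · refine Finset.prod_congr rfl fun k hk => ?_
      rw [if_neg]
      intro hkj
      exact (mem_erase.mp hk).1 (natCast_sq_inj hp (mem_erase.mp hk).2 hj hkj)
    · refine Finset.prod_congr rfl fun t ht => ?_
      rw [if_neg]
      intro htj
      exact (mem_erase.mp ht).1
        ((mul_eq_left₀ (ne_zero_of_mem_nonzeroSquares hj')).mp htj)
  rw [Finset.prod_congr rfl key,
    prod_natCast_sq hp fun s => ∏ t ∈ (nonzeroSquares p).erase 1, F s (s * t),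
    Finset.prod_comm]

theorem prod_mul_nonzeroSquares {M : Type*} [CommMonoid M] {a : ZMod p} (ha : a ≠ 0)
    (F : ZMod p → M) :
    ∏ s ∈ nonzeroSquares p, F (a * s) =
      ∏ x ∈ univ.filter (fun x => quadraticChar (ZMod p) x = quadraticChar (ZMod p) a), F x := by
  refine Finset.prod_nbij' (fun s => a * s) (fun x => a⁻¹ * x) ?_ ?_ ?_ ?_ ?_
  · intro s hs
    rw [mem_filter, map_mul, mem_nonzeroSquares.mp hs, mul_one]
    exact ⟨mem_univ _, rfl⟩
  · intro x hx
    rw [mem_filter] at hx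
    rw [mem_nonzeroSquares, map_mul, hx.2, ← map_mul, inv_mul_cancel₀ ha, map_one]
  · exact fun s _ => inv_mul_cancel_left₀ ha s
  · exact fun s _ => mul_inv_cancel_left₀ ha s
  · exact fun _ _ => rfl

/-- If `a b` is a non-residue, the cosets `a S` and `b S` of the group `S` of nonzero squares
partition the nonzero residues. -/
theorem prod_cosets_nonzeroSquares {M : Type*} [CommMonoid M] {a b : ZMod p}
    (hab : quadraticChar (ZMod p) (a * b) = -1) (F : ZMod p → M) :
    (∏ s ∈ nonzeroSquares p, F (a * s)) * ∏ s ∈ nonzeroSquares p, F (b * s) =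
      ∏ x ∈ univ.erase 0, F x := by
  have ha : a ≠ 0 := by rintro rfl; simp at hab
  have hb : b ≠ 0 := by rintro rfl; simp at hab
  have hneg : quadraticChar (ZMod p) b = -quadraticChar (ZMod p) a := by
    rw [map_mul] at hab
    rcases quadraticChar_dichotomy ha with h | h <;> rw [h] at hab ⊢ <;> omega
  rw [prod_mul_nonzeroSquares ha, prod_mul_nonzeroSquares hb, ← Finset.prod_union]
  · refine Finset.prod_congr ?_ fun _ _ => rfl
    ext x
    simp only [mem_union, mem_filter, mem_univ, true_and, mem_erase, and_true, hneg]
    constructor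
    · rintro h rfl
      rw [quadraticChar_zero] at h
      rcases quadraticChar_dichotomy ha with h' | h' <;> omega
    · intro hx
      rcases quadraticChar_dichotomy ha with h' | h' <;>
        rcases quadraticChar_dichotomy hx with h | h <;> omega
  · rw [Finset.disjoint_left]
    intro x
    simp only [mem_filter, mem_univ, true_and, hneg]
    rcases quadraticChar_dichotomy ha with h' | h' <;> omega

theorem prod_erase_zero_eq {M : Type*} [CommMonoid M] (F : ZMod p → M) :
    ∏ x ∈ univ.erase 0, F x = ∏ k ∈ Icc 1 (p - 1), F (k : ZMod p) := by
  have hp := (Fact.out : p.Prime).two_le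
  refine Finset.prod_nbij' ZMod.val (fun k : ℕ => (k : ZMod p)) ?_ ?_ ?_ ?_ ?_
  · intro x hx
    have h1 := ZMod.val_lt x
    have h2 : x.val ≠ 0 := by
      rw [Ne, ZMod.val_eq_zero]
      exact (mem_erase.mp hx).1
    rw [mem_Icc]
    omega
  · intro k hk
    rw [mem_Icc] at hk
    exact mem_erase.mpr ⟨natCast_ne_zero_of_lt hk.1 (by omega), mem_univ _⟩
  · intro x _
    simp
  · intro k hk
    rw [mem_Icc] at hk
    exact ZMod.val_cast_of_lt (by omega)
  · intro x _
    simp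

/-- The roots of `X ^ n - 1` in `ZMod p`, with `p = 2 n + 1`, are the nonzero squares. -/
theorem prod_sub_nonzeroSquares {n : ℕ} (hp : p = 2 * n + 1) (hn : 0 < n) :
    ∏ s ∈ nonzeroSquares p, (Polynomial.X - Polynomial.C s) =
      (Polynomial.X ^ n - 1 : Polynomial (ZMod p)) := by
  have hdeg :
      (∏ s ∈ nonzeroSquares p, (Polynomial.X - Polynomial.C s)).degree = (n : WithBot ℕ) := by
    rw [Polynomial.degree_prod]
    simp [card_nonzeroSquares hp]
  refine Polynomial.eq_of_degree_sub_lt_of_eval_finset_eq (nonzeroSquares p) ?_ ?_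
  · rw [card_nonzeroSquares hp, ← hdeg]
    apply Polynomial.degree_sub_lt_left
    · rw [hdeg, ← Polynomial.C_1, Polynomial.degree_X_pow_sub_C hn]
    · intro h
      rw [h, Polynomial.degree_zero] at hdeg
      simp at hdeg
    · rw [(Polynomial.monic_prod_X_sub_C _ _).leadingCoeff, ← Polynomial.C_1,
        (Polynomial.monic_X_pow_sub_C _ hn.ne').leadingCoeff]
  · intro s hs
    rw [Polynomial.eval_prod, Finset.prod_eq_zero hs (by simp)]
    have hchar : ringChar (ZMod p) ≠ 2 := by
      rw [ZMod.ringChar_zmod_n]; omega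
    have h := quadraticChar_eq_pow_of_char_ne_two' hchar s
    rw [mem_nonzeroSquares.mp hs, ZMod.card, show p / 2 = n by omega] at h
    simp [← h]

end Squares

/-! ### The product of the differences `k² - j²` modulo `p` -/

section Discriminant

variable {p : ℕ} [Fact p.Prime]

theorem prod_nonzeroSquares_eq {n : ℕ} (hp : p = 2 * n + 1) (hn : 0 < n) (heven : Even n) :
    ∏ s ∈ nonzeroSquares p, s = -1 := by
  have h := congrArg (Polynomial.eval 0) (prod_sub_nonzeroSquares hp hn)
  rw [Polynomial.eval_prod] at h
  have hneg : ∏ s ∈ nonzeroSquares p, -s = ∏ s ∈ nonzeroSquares p, s := by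
    rw [Finset.prod_neg, card_nonzeroSquares hp, heven.neg_one_pow, one_mul]
  rw [← hneg]
  simpa [hn.ne'] using h

/-- The derivative of `X ^ n - 1` at its root `1`, computed from the factorisation. -/
theorem prod_one_sub_nonzeroSquares {n : ℕ} (hp : p = 2 * n + 1) (hn : 0 < n) :
    ∏ t ∈ (nonzeroSquares p).erase 1, (1 - t) = (n : ZMod p) := by
  have h : ∏ t ∈ (nonzeroSquares p).erase 1, (Polynomial.X - Polynomial.C t) =
      ∑ i ∈ range n, (Polynomial.X : Polynomial (ZMod p)) ^ i := by
    refine mul_left_cancel₀ (Polynomial.X_sub_C_ne_zero (1 : ZMod p)) ?_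
    rw [Finset.mul_prod_erase _ (fun t => Polynomial.X - Polynomial.C t) one_mem_nonzeroSquares,
      prod_sub_nonzeroSquares hp hn, Polynomial.C_1, mul_geom_sum]
  have h1 := congrArg (Polynomial.eval 1) h
  rw [Polynomial.eval_prod, Polynomial.eval_finsetSum] at h1
  simpa using h1

/-- With `n = 2 m = (p - 1) / 2` one has `2 n = -1` in `ZMod p`, so that `n ^ n` is the Legendre
symbol of `2`, up to the sign `(-1) ^ n = 1`. -/
theorem natCast_half_pow {m : ℕ} (hp : p = 4 * m + 1) :
    ((2 * m : ℕ) : ZMod p) ^ (2 * m) = (-1) ^ m := by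
  have h2 : (2 : ZMod p) ^ (2 * m) = (-1) ^ m := by
    have hchar : ringChar (ZMod p) ≠ 2 := by
      rw [ZMod.ringChar_zmod_n]; omega
    have h := FiniteField.two_pow_card hchar
    rw [ZMod.card, show p / 2 = 2 * m by omega] at h
    rw [h, ZMod.χ₈_nat_eq_if_mod_eight, if_neg (by omega)]
    rcases Nat.even_or_odd' m with ⟨c, rfl | rfl⟩
    · rw [if_pos (by omega), pow_mul]
      simp
    · rw [if_neg (by omega), pow_add, pow_mul]
      simp
  have hmul : (2 : ZMod p) * ((2 * m : ℕ) : ZMod p) = -1 := by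
    have h0 : ((4 * m + 1 : ℕ) : ZMod p) = 0 := by rw [← hp]; exact ZMod.natCast_self p
    push_cast at h0 ⊢
    linear_combination h0
  have hpow := congrArg (· ^ (2 * m)) hmul
  simp only [mul_pow, h2] at hpow
  rw [pow_mul (-1 : ZMod p), neg_one_sq, one_pow] at hpow
  have hsq : ((-1 : ZMod p) ^ m) * (-1) ^ m = 1 := by rw [← mul_pow]; simp
  linear_combination (-1) ^ m * hpow - ((2 * m : ℕ) : ZMod p) ^ (2 * m) * hsq

/-- Up to sign this is the discriminant of `X ^ ((p - 1) / 2) - 1` over `ZMod p`. -/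
theorem prod_sq_sub_sq {m : ℕ} (hp : p = 4 * m + 1) (hm : 0 < m) :
    ∏ j ∈ Icc 1 (2 * m), ∏ k ∈ Ioc j (2 * m), ((k : ZMod p) ^ 2 - (j : ZMod p) ^ 2) ^ 2 = -1 := by
  have hp' : p = 2 * (2 * m) + 1 := by omega
  have heven : Even (2 * m) := even_two_mul m
  have h1 := prod_triangle_symm (2 * m) fun j k => (k : ZMod p) ^ 2 - (j : ZMod p) ^ 2
  rw [prod_offDiag_sq hp' fun s s' => s' - s] at h1
  have hL : ∏ j ∈ Icc 1 (2 * m), ∏ k ∈ Ioc j (2 * m),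
      ((k : ZMod p) ^ 2 - (j : ZMod p) ^ 2) * ((j : ZMod p) ^ 2 - (k : ZMod p) ^ 2) =
      (-1) ^ m * ∏ j ∈ Icc 1 (2 * m), ∏ k ∈ Ioc j (2 * m),
        ((k : ZMod p) ^ 2 - (j : ZMod p) ^ 2) ^ 2 := by
    have he : 2 * m * (2 * m - 1) / 2 = 2 * (m * (m - 1)) + m := by
      obtain ⟨c, rfl⟩ : ∃ c, m = c + 1 := ⟨m - 1, by omega⟩
      rw [mul_assoc, Nat.mul_div_cancel_left _ two_pos, show 2 * (c + 1) - 1 = 2 * c + 1 by omega,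
        Nat.add_sub_cancel]
      ring
    have hc := prod_triangle_const (2 * m) (-1 : ZMod p)
    rw [he, pow_add, pow_mul, neg_one_sq, one_pow, one_mul] at hc
    rw [← hc]
    simp only [← Finset.prod_mul_distrib]
    refine Finset.prod_congr rfl fun j _ => Finset.prod_congr rfl fun k _ => ?_
    ring
  have hR : ∀ t ∈ (nonzeroSquares p).erase 1, ∏ s ∈ nonzeroSquares p, (s * t - s) =
      -1 * (1 - t) ^ (2 * m) := by
    intro t _
    rw [← prod_nonzeroSquares_eq hp' (by omega) heven, ← heven.neg_pow, neg_sub,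
      ← card_nonzeroSquares hp', ← Finset.prod_const, ← Finset.prod_mul_distrib]
    refine Finset.prod_congr rfl fun s _ => ?_
    ring
  have hodd : Odd #((nonzeroSquares p).erase 1) := by
    rw [card_erase_of_mem one_mem_nonzeroSquares, card_nonzeroSquares hp']
    exact Nat.Even.sub_odd (by omega) heven odd_one
  rw [hL, Finset.prod_congr rfl hR, Finset.prod_mul_distrib, Finset.prod_const,
    hodd.neg_one_pow, Finset.prod_pow, prod_one_sub_nonzeroSquares hp' (by omega),
    natCast_half_pow hp] at h1
  have hsq : ((-1 : ZMod p) ^ m) * (-1) ^ m = 1 := by rw [← mul_pow]; simp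
  set D := ∏ j ∈ Icc 1 (2 * m), ∏ k ∈ Ioc j (2 * m), ((k : ZMod p) ^ 2 - (j : ZMod p) ^ 2) ^ 2
  linear_combination (-1) ^ m * h1 - D * hsq - hsq

end Discriminant

/-! ### Products of differences of `p`-th roots of unity -/

section AdditiveCharacter

variable {p : ℕ} [Fact p.Prime]

theorem isPrimitiveRoot_stdAddChar_one :
    IsPrimitiveRoot (ZMod.stdAddChar (1 : ZMod p)) p := by
  have h := ZMod.stdAddChar_coe (N := p) 1
  rw [Int.cast_one, Int.cast_one, mul_one] at h
  rw [h]
  exact Complex.isPrimitiveRoot_exp p (NeZero.ne p)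

theorem stdAddChar_natCast (k : ℕ) :
    ZMod.stdAddChar (k : ZMod p) = ZMod.stdAddChar (1 : ZMod p) ^ k := by
  rw [← AddChar.map_nsmul_eq_pow, nsmul_one]

theorem prod_one_sub_stdAddChar :
    ∏ x ∈ (univ : Finset (ZMod p)).erase 0, (1 - ZMod.stdAddChar x) = (p : ℂ) := by
  obtain ⟨q, hq⟩ : ∃ q, p = q + 1 := ⟨p - 1, by have := (Fact.out : p.Prime).pos; omega⟩
  have hprim := isPrimitiveRoot_stdAddChar_one (p := p)
  have h := (hq ▸ hprim : IsPrimitiveRoot (ZMod.stdAddChar (1 : ZMod p)) (q + 1))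
    |>.prod_one_sub_pow_eq_order
  rw [prod_erase_zero_eq]
  rw [show (p : ℂ) = q + 1 by rw [hq]; push_cast; rfl, ← h]
  refine Finset.prod_nbij' (fun k => k - 1) (fun k => k + 1) ?_ ?_ ?_ ?_ ?_
  · intro k; simp only [mem_Icc, mem_range]; omega
  · intro k; simp only [mem_Icc, mem_range]; omega
  · intro k; simp only [mem_Icc]; omega
  · intro k; simp
  · intro k hk
    rw [mem_Icc] at hk
    rw [stdAddChar_natCast, show k - 1 + 1 = k by omega]

theorem prod_stdAddChar (hp : 2 < p) :
    ∏ x ∈ (univ : Finset (ZMod p)).erase 0, ZMod.stdAddChar x = 1 := by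
  rw [Finset.prod_erase _ (AddChar.map_zero_eq_one _)]
  have h := FiniteField.sum_pow_lt_card_sub_one (ZMod p) 1 (by rw [ZMod.card]; omega)
  simp only [pow_one] at h
  have hsum := map_prod (ZMod.stdAddChar (N := p)).toMonoidHom
    (fun x => Multiplicative.ofAdd x) univ
  rw [← ofAdd_sum, h] at hsum
  exact hsum.symm.trans (map_one _)

/-- For a fixed ratio `t ≠ 1` the differences `ζ ^ x - ζ ^ (x t)` are units `ζ ^ x` times
`1 - ζ ^ (x (t - 1))`, and `x (t - 1)` runs through all nonzero residues. -/
theorem prod_stdAddChar_sub_mul (hp : 2 < p) {t : ZMod p} (ht : t ≠ 1) :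
    ∏ x ∈ (univ : Finset (ZMod p)).erase 0,
      (ZMod.stdAddChar x - ZMod.stdAddChar (x * t)) = (p : ℂ) := by
  have h : ∀ x : ZMod p, ZMod.stdAddChar x - ZMod.stdAddChar (x * t) =
      ZMod.stdAddChar x * (1 - ZMod.stdAddChar (x * (t - 1))) := by
    intro x
    rw [mul_sub, mul_one, ← AddChar.map_add_eq_mul]
    ring_nf
  have ht' : t - 1 ≠ 0 := sub_ne_zero.mpr ht
  simp only [h]
  rw [Finset.prod_mul_distrib, prod_stdAddChar hp, one_mul, ← prod_one_sub_stdAddChar]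
  refine Finset.prod_nbij' (fun x => x * (t - 1)) (fun x => x * (t - 1)⁻¹) ?_ ?_ ?_ ?_ ?_
  · intro x hx; simpa [ht'] using hx
  · intro x hx; simpa [ht'] using hx
  · intro x _; exact mul_inv_cancel_right₀ ht' x
  · intro x _; exact inv_mul_cancel_right₀ ht' x
  · intro _ _; rfl

/-- The product of `(ζ^{aj²} - ζ^{ak²})(ζ^{bj²} - ζ^{bk²})` over `1 ≤ j < k ≤ n`. -/
noncomputable def sqDiffProd (p : ℕ) [Fact p.Prime] (n : ℕ) (a b : ZMod p) : ℂ :=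
  ∏ j ∈ Icc 1 n, ∏ k ∈ Ioc j n,
    ((ZMod.stdAddChar (a * (j : ZMod p) ^ 2) - ZMod.stdAddChar (a * (k : ZMod p) ^ 2)) *
      (ZMod.stdAddChar (b * (j : ZMod p) ^ 2) - ZMod.stdAddChar (b * (k : ZMod p) ^ 2)))

/-- The square is a product over ordered pairs `(x, x t)` with `t ≠ 1` a square and `x` in one of
the two cosets of squares; each of the `n - 1` values of `t` contributes a factor `p`. -/
theorem sqDiffProd_sq {n : ℕ} (hp : p = 2 * n + 1) (hn : 0 < n) {a b : ZMod p}
    (hab : quadraticChar (ZMod p) (a * b) = -1) :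
    sqDiffProd p n a b ^ 2 = (p : ℂ) ^ (n - 1) := by
  have h := prod_triangle_symm n fun j k =>
    (ZMod.stdAddChar (a * (j : ZMod p) ^ 2) - ZMod.stdAddChar (a * (k : ZMod p) ^ 2)) *
      (ZMod.stdAddChar (b * (j : ZMod p) ^ 2) - ZMod.stdAddChar (b * (k : ZMod p) ^ 2))
  rw [prod_offDiag_sq hp fun s s' =>
    (ZMod.stdAddChar (a * s) - ZMod.stdAddChar (a * s')) *
      (ZMod.stdAddChar (b * s) - ZMod.stdAddChar (b * s'))] at h
  have hR : ∀ t ∈ (nonzeroSquares p).erase 1, ∏ s ∈ nonzeroSquares p,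
      (ZMod.stdAddChar (a * s) - ZMod.stdAddChar (a * (s * t))) *
        (ZMod.stdAddChar (b * s) - ZMod.stdAddChar (b * (s * t))) = (p : ℂ) := by
    intro t ht
    rw [← prod_stdAddChar_sub_mul (by omega) (mem_erase.mp ht).1, Finset.prod_mul_distrib,
      ← prod_cosets_nonzeroSquares hab]
    simp only [mul_assoc]
  rw [Finset.prod_congr rfl hR, Finset.prod_const,
    card_erase_of_mem one_mem_nonzeroSquares, card_nonzeroSquares hp] at h
  rw [← h, sqDiffProd, sq, ← Finset.prod_mul_distrib]
  refine Finset.prod_congr rfl fun j _ => ?_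
  rw [← Finset.prod_mul_distrib]
  refine Finset.prod_congr rfl fun k _ => ?_
  ring

/-- Since `n ≡ -1/2` modulo `p`, the left side is `ζ ^ (-k/2) - ζ ^ (k/2)`. The halves are taken
modulo `p`, and going over to `e ^ (∓π i k / p)` costs the sign `(-1) ^ k`. -/
theorem stdAddChar_half_sub {n : ℕ} (hp : p = 2 * n + 1) (k : ℕ) :
    ZMod.stdAddChar ((n * k : ℕ) : ZMod p) * (1 - ZMod.stdAddChar (k : ZMod p)) =
      (-1) ^ k * (-2 * Complex.I * (Real.sin (Real.pi * k / p) : ℂ)) := by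
  have hp0 : (p : ℂ) ≠ 0 := Nat.cast_ne_zero.mpr (NeZero.ne p)
  have hpn : (p : ℂ) = 2 * n + 1 := by rw [hp]; push_cast; rfl
  have h1 : ZMod.stdAddChar ((n * k : ℕ) : ZMod p) =
      (-1) ^ k * Complex.exp (-(Real.pi * k / p : ℂ) * Complex.I) := by
    have h := ZMod.stdAddChar_coe (N := p) ((n * k : ℕ) : ℤ)
    rw [Int.cast_natCast] at h
    rw [h, ← Complex.exp_pi_mul_I, ← Complex.exp_nat_mul, ← Complex.exp_add]
    congr 1
    push_cast
    field_simp
    rw [hpn]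
    ring
  have h2 : ZMod.stdAddChar (k : ZMod p) =
      Complex.exp ((Real.pi * k / p : ℂ) * Complex.I) *
        Complex.exp ((Real.pi * k / p : ℂ) * Complex.I) := by
    have h := ZMod.stdAddChar_coe (N := p) (k : ℤ)
    rw [Int.cast_natCast] at h
    rw [h, ← Complex.exp_add]
    congr 1
    push_cast
    ring
  have h3 : Complex.exp (-(Real.pi * k / p : ℂ) * Complex.I) *
      Complex.exp ((Real.pi * k / p : ℂ) * Complex.I) = 1 := by
    rw [← Complex.exp_add, neg_mul, neg_add_cancel, Complex.exp_zero]
  rw [h1, h2]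
  push_cast
  rw [Complex.sin]
  linear_combination (-(-1) ^ k * Complex.exp ((Real.pi * k / p : ℂ) * Complex.I)) * h3 +
    (-1) ^ k * (Complex.exp (-(Real.pi * k / p : ℂ) * Complex.I) -
      Complex.exp ((Real.pi * k / p : ℂ) * Complex.I)) * Complex.I_sq

/-- The positive square root of `p` as an explicit element of `ℤ[ζ]`: the product is
`∏ 2 sin (π k / p)`, hence positive, and its square is `∏ (1 - ζ ^ k) = p`. This replaces the
evaluation of the sign of the quadratic Gauss sum. -/
theorem prod_stdAddChar_half_eq_sqrt {m : ℕ} (hp : p = 4 * m + 1) :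
    ∏ k ∈ Icc 1 (2 * m), ZMod.stdAddChar ((2 * m * k : ℕ) : ZMod p) *
      (1 - ZMod.stdAddChar (k : ZMod p)) = ((Real.sqrt p : ℝ) : ℂ) := by
  have hp' : p = 2 * (2 * m) + 1 := by omega
  set r : ℝ := ∏ k ∈ Icc 1 (2 * m), 2 * Real.sin (Real.pi * k / p) with hr
  have hpos : 0 < r := by
    refine Finset.prod_pos fun k hk => ?_
    rw [mem_Icc] at hk
    have hp0 : (0 : ℝ) < p := Nat.cast_pos.mpr (NeZero.pos p)
    have hk0 : (0 : ℝ) < k := Nat.cast_pos.mpr hk.1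
    have hkp : (k : ℝ) < p := Nat.cast_lt.mpr (by omega)
    refine mul_pos two_pos (Real.sin_pos_of_pos_of_lt_pi (by positivity) ?_)
    rw [div_lt_iff₀ hp0]
    exact mul_lt_mul_of_pos_left hkp Real.pi_pos
  have hT : ∏ k ∈ Icc 1 (2 * m), ZMod.stdAddChar ((2 * m * k : ℕ) : ZMod p) *
      (1 - ZMod.stdAddChar (k : ZMod p)) = (r : ℂ) := by
    have hsum : ∑ k ∈ Icc 1 (2 * m), k = 2 * (m * m) + m := by
      have h1 := Finset.sum_range_id_mul_two (2 * m + 1)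
      rw [Finset.sum_range_succ', Nat.add_sub_cancel] at h1
      have h2 : ∑ k ∈ Icc 1 (2 * m), k = ∑ k ∈ range (2 * m), (k + 1) :=
        Finset.sum_nbij' (fun j => j - 1) (fun j => j + 1)
          (by simp only [mem_Icc, mem_range]; omega) (by simp only [mem_Icc, mem_range]; omega)
          (by simp only [mem_Icc]; omega) (by simp) (by simp only [mem_Icc]; omega)
      rw [h2]
      nlinarith
    have hsign : ∏ k ∈ Icc 1 (2 * m), ((-1 : ℂ) ^ k * -Complex.I) = 1 := by
      rw [Finset.prod_mul_distrib, Finset.prod_pow_eq_pow_sum, hsum, Finset.prod_const,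
        Nat.card_Icc, Nat.add_sub_cancel, pow_add, pow_mul, neg_one_sq, one_pow, one_mul,
        pow_mul (-Complex.I), neg_sq, Complex.I_sq, ← mul_pow]
      simp
    have hsplit : (r : ℂ) = (∏ k ∈ Icc 1 (2 * m), ((-1 : ℂ) ^ k * -Complex.I)) * r := by
      rw [hsign, one_mul]
    rw [Finset.prod_congr rfl fun k _ => stdAddChar_half_sub hp' k, hsplit, hr,
      Complex.ofReal_prod, ← Finset.prod_mul_distrib]
    refine Finset.prod_congr rfl fun k _ => ?_
    push_cast
    ring
  have hsq : (r : ℂ) ^ 2 = p := by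
    have hterm : ∀ k ∈ Icc 1 (2 * m),
        (ZMod.stdAddChar ((2 * m * k : ℕ) : ZMod p) * (1 - ZMod.stdAddChar (k : ZMod p))) ^ 2 =
          -1 * ((1 - ZMod.stdAddChar (k : ZMod p)) *
            (1 - ZMod.stdAddChar ((2 * (2 * m) + 1 - k : ℕ) : ZMod p))) := by
      intro k hk
      rw [mem_Icc] at hk
      have h0 : ((4 * m + 1 : ℕ) : ZMod p) = 0 := by rw [← hp]; exact ZMod.natCast_self p
      have h1 : ZMod.stdAddChar ((2 * m * k : ℕ) : ZMod p) ^ 2 =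
          ZMod.stdAddChar ((2 * (2 * m) + 1 - k : ℕ) : ZMod p) := by
        rw [sq, ← AddChar.map_add_eq_mul, Nat.cast_sub (by omega)]
        congr 1
        push_cast at h0 ⊢
        linear_combination (k - 1 : ZMod p) * h0
      have h2 : ZMod.stdAddChar ((2 * (2 * m) + 1 - k : ℕ) : ZMod p) *
          ZMod.stdAddChar (k : ZMod p) = 1 := by
        rw [← AddChar.map_add_eq_mul, ← Nat.cast_add,
          show 2 * (2 * m) + 1 - k + k = 4 * m + 1 by omega, h0, AddChar.map_zero_eq_one]
      rw [mul_pow, h1]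
      linear_combination (ZMod.stdAddChar (k : ZMod p) - 1) * h2
    rw [← hT, ← Finset.prod_pow, Finset.prod_congr rfl hterm, Finset.prod_mul_distrib,
      ← prod_Icc_two_mul (2 * m) fun k => 1 - ZMod.stdAddChar (k : ZMod p),
      ← prod_one_sub_stdAddChar, prod_erase_zero_eq, show p - 1 = 2 * (2 * m) by omega,
      Finset.prod_const, Nat.card_Icc, Nat.add_sub_cancel, pow_mul, neg_one_sq, one_pow, one_mul]
  rw [hT]
  congr 1
  have hsq' : r ^ 2 = p := by exact_mod_cast hsq
  rw [← hsq', Real.sqrt_sq hpos.le]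

/-- A polynomial over `ℤ` vanishing at `ζ` is divisible by the `p`-th cyclotomic polynomial, which
takes the value `p` at `1`. -/
theorem dvd_eval_one_of_aeval_eq_zero {P : Polynomial ℤ}
    (hP : Polynomial.aeval (ZMod.stdAddChar (1 : ZMod p)) P = 0) : (p : ℤ) ∣ P.eval 1 := by
  have hprim := isPrimitiveRoot_stdAddChar_one (p := p)
  have hdvd := minpoly.isIntegrallyClosed_dvd (hprim.isIntegral (NeZero.pos p)) hP
  rw [← Polynomial.cyclotomic_eq_minpoly hprim (NeZero.pos p)] at hdvd
  have h := Polynomial.eval_dvd hdvd (x := 1)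
  rwa [Polynomial.eval_one_cyclotomic_prime] at h

end AdditiveCharacter

/-! ### Residues modulo `1 - ζ` -/

section LeadingCoefficient

variable {p : ℕ} [Fact p.Prime]

/-- `HasLeadingCoeff z N c` says that, with `ζ = e^{2πi/p}`, the number `z` is
`(1 - ζ) ^ N` times an element of `ℤ[ζ]` whose class in `ℤ[ζ] / (1 - ζ) ≅ ZMod p` is `c`.
The element of `ℤ[ζ]` is given as the value at `ζ` of an integer polynomial, and its residue class
is then the value of that polynomial at `1`. -/
def HasLeadingCoeff (z : ℂ) (N : ℕ) (c : ZMod p) : Prop :=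
  ∃ P : Polynomial ℤ, Polynomial.aeval (ZMod.stdAddChar (1 : ZMod p)) P *
    (1 - ZMod.stdAddChar (1 : ZMod p)) ^ N = z ∧ ((P.eval 1 : ℤ) : ZMod p) = c

namespace HasLeadingCoeff

theorem mul {z w : ℂ} {N M : ℕ} {c d : ZMod p} (hz : HasLeadingCoeff z N c)
    (hw : HasLeadingCoeff w M d) : HasLeadingCoeff (z * w) (N + M) (c * d) := by
  obtain ⟨P, rfl, rfl⟩ := hz
  obtain ⟨Q, rfl, rfl⟩ := hw
  refine ⟨P * Q, ?_, ?_⟩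
  · rw [map_mul]; ring
  · rw [Polynomial.eval_mul, Int.cast_mul]

theorem intCast (k : ℤ) : HasLeadingCoeff (k : ℂ) 0 (k : ZMod p) :=
  ⟨Polynomial.C k, by simp, by simp⟩

theorem one : HasLeadingCoeff 1 0 (1 : ZMod p) := by
  simpa using intCast (p := p) 1

theorem prod {ι : Type*} {s : Finset ι} {f : ι → ℂ} {N : ι → ℕ} {c : ι → ZMod p}
    (h : ∀ i ∈ s, HasLeadingCoeff (f i) (N i) (c i)) :
    HasLeadingCoeff (∏ i ∈ s, f i) (∑ i ∈ s, N i) (∏ i ∈ s, c i) := by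
  classical
  induction s using Finset.induction_on with
  | empty => simpa using one
  | insert a s ha ih =>
    rw [prod_insert ha, sum_insert ha, prod_insert ha]
    exact (h a (mem_insert_self a s)).mul (ih fun i hi => h i (mem_insert_of_mem hi))

theorem pow {z : ℂ} {N : ℕ} {c : ZMod p} (h : HasLeadingCoeff z N c) (k : ℕ) :
    HasLeadingCoeff (z ^ k) (k * N) (c ^ k) := by
  simpa using prod (s := range k) fun _ _ => h

theorem unique {z : ℂ} {N : ℕ} {c d : ZMod p} (hc : HasLeadingCoeff z N c)
    (hd : HasLeadingCoeff z N d) : c = d := by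
  obtain ⟨P, hP, rfl⟩ := hc
  obtain ⟨Q, hQ, rfl⟩ := hd
  have hne : (1 - ZMod.stdAddChar (1 : ZMod p)) ^ N ≠ 0 :=
    pow_ne_zero _ (sub_ne_zero.mpr
      (isPrimitiveRoot_stdAddChar_one.ne_one (Fact.out : p.Prime).one_lt).symm)
  have h : Polynomial.aeval (ZMod.stdAddChar (1 : ZMod p)) (P - Q) = 0 := by
    rw [map_sub, sub_eq_zero]
    exact mul_right_cancel₀ hne (hP.trans hQ.symm)
  have hdvd := dvd_eval_one_of_aeval_eq_zero h
  rwa [← ZMod.intCast_zmod_eq_zero_iff_dvd, Polynomial.eval_sub, Int.cast_sub, sub_eq_zero] at hdvd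

theorem stdAddChar (x : ZMod p) : HasLeadingCoeff (ZMod.stdAddChar x) 0 (1 : ZMod p) := by
  refine ⟨Polynomial.X ^ x.val, ?_, by simp⟩
  rw [pow_zero, mul_one, map_pow, Polynomial.aeval_X, ← stdAddChar_natCast, ZMod.natCast_zmod_val]

theorem one_sub_stdAddChar (x : ZMod p) : HasLeadingCoeff (1 - ZMod.stdAddChar x) 1 x := by
  refine ⟨∑ i ∈ range x.val, Polynomial.X ^ i, ?_, ?_⟩
  · simp only [map_sum, map_pow, Polynomial.aeval_X, pow_one]
    rw [geom_sum_mul_neg, ← stdAddChar_natCast, ZMod.natCast_zmod_val]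
  · simp [Polynomial.eval_finsetSum]

theorem stdAddChar_sub (x y : ZMod p) :
    HasLeadingCoeff (ZMod.stdAddChar x - ZMod.stdAddChar y) 1 (y - x) := by
  have h := (stdAddChar x).mul (one_sub_stdAddChar (y - x))
  rwa [mul_sub, mul_one, ← AddChar.map_add_eq_mul, add_sub_cancel, zero_add, one_mul] at h

/-- The prime `p = ∏ (1 - ζ ^ k)` has leading coefficient `(p - 1)! = -1`. -/
theorem natCast_prime : HasLeadingCoeff (p : ℂ) (p - 1) (-1 : ZMod p) := by
  have h := prod (s := Icc 1 (p - 1)) fun (k : ℕ) _ => one_sub_stdAddChar (k : ZMod p)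
  rw [← prod_erase_zero_eq fun x => 1 - ZMod.stdAddChar x, prod_one_sub_stdAddChar] at h
  rw [← ZMod.wilsons_lemma, ← prod_Icc_natCast]
  simpa using h

/-- The sign matters here: `√p`, and not `-√p`, has leading coefficient `((p - 1) / 2)!`. -/
theorem sqrt_prime {m : ℕ} (hp : p = 4 * m + 1) :
    HasLeadingCoeff ((Real.sqrt p : ℝ) : ℂ) (2 * m) ((2 * m).factorial : ZMod p) := by
  have h := prod (s := Icc 1 (2 * m)) fun (k : ℕ) _ =>
    (stdAddChar ((2 * m * k : ℕ) : ZMod p)).mul (one_sub_stdAddChar (k : ZMod p))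
  rw [prod_stdAddChar_half_eq_sqrt hp] at h
  rw [← prod_Icc_natCast]
  simpa using h

end HasLeadingCoeff

theorem two_mul_mul_pred_div_two (m : ℕ) : 2 * m * (2 * m - 1) / 2 = m * (2 * m - 1) := by
  rw [mul_assoc, Nat.mul_div_cancel_left _ two_pos]

/-- The leading coefficient is `(a b) ^ (n (n - 1) / 2) ∏ (k² - j²)²`, with `n = 2 m`, and the last
product is `-1`. -/
theorem hasLeadingCoeff_sqDiffProd {m : ℕ} (hp : p = 4 * m + 1) (hm : 0 < m) (a b : ZMod p) :
    HasLeadingCoeff (sqDiffProd p (2 * m) a b) (m * (2 * m - 1) * 2)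
      (-(a * b) ^ (m * (2 * m - 1))) := by
  have h := HasLeadingCoeff.prod (s := Icc 1 (2 * m)) fun (j : ℕ) _ =>
    HasLeadingCoeff.prod (s := Ioc j (2 * m)) fun (k : ℕ) _ =>
      (HasLeadingCoeff.stdAddChar_sub (a * (j : ZMod p) ^ 2) (a * (k : ZMod p) ^ 2)).mul
        (HasLeadingCoeff.stdAddChar_sub (b * (j : ZMod p) ^ 2) (b * (k : ZMod p) ^ 2))
  convert h using 1
  · rfl
  · have hc := congrArg Multiplicative.toAdd
      (prod_triangle_const (2 * m) (Multiplicative.ofAdd (1 + 1)))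
    rw [two_mul_mul_pred_div_two] at hc
    simpa [toAdd_prod] using hc.symm
  · have hc := prod_triangle_const (2 * m) (a * b)
    rw [two_mul_mul_pred_div_two] at hc
    rw [← hc, ← mul_neg_one, ← prod_sq_sub_sq hp hm]
    simp only [← Finset.prod_mul_distrib]
    refine Finset.prod_congr rfl fun j _ => Finset.prod_congr rfl fun k _ => ?_
    ring

/-- The square of the product determines it up to a sign `ε`, and comparing leading coefficients
gives `-(a b) ^ m = ε (2 m)!` in `ZMod p`. -/
theorem sqDiffProd_eq {m : ℕ} (hp : p = 4 * m + 1) (hm : 0 < m) {a b : ZMod p}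
    (hab : quadraticChar (ZMod p) (a * b) = -1) :
    sqDiffProd p (2 * m) a b =
      ((-(if (a * b) ^ m = ((2 * m).factorial : ZMod p) then 1 else -1 : ℤ) : ℤ) : ℂ) *
        ((p : ℂ) ^ (m - 1) * ((Real.sqrt p : ℝ) : ℂ)) := by
  have hsqrt : ((Real.sqrt p : ℝ) : ℂ) ^ 2 = p := by
    rw [← Complex.ofReal_pow, Real.sq_sqrt (Nat.cast_nonneg p), Complex.ofReal_natCast]
  have hsq : sqDiffProd p (2 * m) a b ^ 2 =
      ((p : ℂ) ^ (m - 1) * ((Real.sqrt p : ℝ) : ℂ)) ^ 2 := by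
    rw [sqDiffProd_sq (by omega) (by omega) hab, mul_pow, hsqrt, ← pow_mul, ← pow_succ]
    congr 1
    omega
  obtain ⟨ε, hε, hQ⟩ : ∃ ε : ℤ, (ε = 1 ∨ ε = -1) ∧ sqDiffProd p (2 * m) a b =
      (ε : ℂ) * ((p : ℂ) ^ (m - 1) * ((Real.sqrt p : ℝ) : ℂ)) := by
    rcases sq_eq_sq_iff_eq_or_eq_neg.mp hsq with h | h
    · exact ⟨1, Or.inl rfl, by simpa using h⟩
    · exact ⟨-1, Or.inr rfl, by simpa using h⟩
  have hchar : ringChar (ZMod p) ≠ 2 := by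
    rw [ZMod.ringChar_zmod_n]; omega
  -- Euler's criterion: `(a b) ^ (2 m)` is the quadratic character of `a b`.
  have heuler : (a * b) ^ (2 * m) = -1 := by
    have h := quadraticChar_eq_pow_of_char_ne_two' hchar (a * b)
    rw [hab, ZMod.card, show p / 2 = 2 * m by omega] at h
    rw [← h]
    simp
  have hcoeff : -(a * b) ^ (m * (2 * m - 1)) =
      (ε : ZMod p) * ((-1) ^ (m - 1) * ((2 * m).factorial : ZMod p)) := by
    have h1 := hasLeadingCoeff_sqDiffProd hp hm a b
    have h2 := (HasLeadingCoeff.intCast (p := p) ε).mul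
      ((HasLeadingCoeff.natCast_prime.pow (m - 1)).mul (HasLeadingCoeff.sqrt_prime hp))
    rw [← hQ, show 0 + ((m - 1) * (p - 1) + 2 * m) = m * (2 * m - 1) * 2 by
      obtain ⟨c, rfl⟩ : ∃ c, m = c + 1 := ⟨m - 1, by omega⟩
      rw [hp, Nat.add_sub_cancel, Nat.add_sub_cancel, show 2 * (c + 1) - 1 = 2 * c + 1 by omega]
      ring] at h2
    exact h1.unique h2
  have hpow : -(a * b) ^ m = (ε : ZMod p) * ((2 * m).factorial : ZMod p) := by
    obtain ⟨c, rfl⟩ : ∃ c, m = c + 1 := ⟨m - 1, by omega⟩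
    rw [show (c + 1) * (2 * (c + 1) - 1) = 2 * (c + 1) * c + (c + 1) by
      rw [show 2 * (c + 1) - 1 = 2 * c + 1 by omega]; ring, pow_add, pow_mul, heuler,
      Nat.add_sub_cancel] at hcoeff
    have hone : ((-1 : ZMod p) ^ c) * (-1) ^ c = 1 := by rw [← mul_pow]; simp
    linear_combination (-1) ^ c * hcoeff +
      ((a * b) ^ (c + 1) + (ε : ZMod p) * ((2 * (c + 1)).factorial : ZMod p)) * hone
  have hfact : ((2 * m).factorial : ZMod p) ≠ 0 := by
    rw [Ne, ZMod.natCast_eq_zero_iff, (Fact.out : p.Prime).dvd_factorial]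
    omega
  rw [hQ]
  congr 2
  rcases hε with rfl | rfl
  · rw [if_neg, neg_neg]
    intro h
    rw [h, Int.cast_one, one_mul, neg_eq_iff_add_eq_zero, ← two_mul] at hpow
    exact (mul_ne_zero (Ring.two_ne_zero hchar) hfact) hpow
  · rw [if_pos]
    simpa using hpow

end LeadingCoefficient

/-! ### Differences of cotangents -/

section Cotangent

variable {p : ℕ} [Fact p.Prime]

theorem stdAddChar_ne_one {x : ZMod p} (hx : x ≠ 0) : ZMod.stdAddChar x ≠ 1 := by
  rw [← AddChar.map_zero_eq_one (ZMod.stdAddChar (N := p))]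
  exact fun h => hx (ZMod.injective_stdAddChar h)

theorem ofReal_cot_eq_stdAddChar (z : ℤ) :
    ((Real.cot (Real.pi * ((z : ℝ) / p)) : ℝ) : ℂ) =
      (ZMod.stdAddChar (z : ZMod p) + 1) / (Complex.I * (1 - ZMod.stdAddChar (z : ZMod p))) := by
  rw [Complex.ofReal_cot, Complex.cot_eq_exp_ratio, ZMod.stdAddChar_coe]
  have h : 2 * Complex.I * ((Real.pi * ((z : ℝ) / p) : ℝ) : ℂ) =
      2 * Real.pi * Complex.I * z / p := by
    push_cast
    ring
  rw [h]

theorem ofReal_cot_sub_cot {z w : ℤ} (hz : (z : ZMod p) ≠ 0) (hw : (w : ZMod p) ≠ 0) :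
    ((Real.cot (Real.pi * ((z : ℝ) / p)) - Real.cot (Real.pi * ((w : ℝ) / p)) : ℝ) : ℂ) =
      -2 * Complex.I * (ZMod.stdAddChar (z : ZMod p) - ZMod.stdAddChar (w : ZMod p)) /
        ((1 - ZMod.stdAddChar (z : ZMod p)) * (1 - ZMod.stdAddChar (w : ZMod p))) := by
  rw [Complex.ofReal_sub, ofReal_cot_eq_stdAddChar, ofReal_cot_eq_stdAddChar]
  have h1 := sub_ne_zero.mpr (stdAddChar_ne_one hz).symm
  have h2 := sub_ne_zero.mpr (stdAddChar_ne_one hw).symm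
  have hI := Complex.I_ne_zero
  field_simp
  rw [Complex.I_sq]
  ring

/-- The product of `(cot (π a j² / p) - cot (π a k² / p)) (cot (π b j² / p) - cot (π b k² / p))`
over `1 ≤ j < k ≤ n`. -/
noncomputable def cotDiffProd (p n : ℕ) (a b : ℤ) : ℝ :=
  ∏ j ∈ Icc 1 n, ∏ k ∈ Ioc j n,
    ((Real.cot (Real.pi * ((a : ℝ) * (j : ℝ) ^ 2 / (p : ℝ))) -
        Real.cot (Real.pi * ((a : ℝ) * (k : ℝ) ^ 2 / (p : ℝ)))) *
      (Real.cot (Real.pi * ((b : ℝ) * (j : ℝ) ^ 2 / (p : ℝ))) -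
        Real.cot (Real.pi * ((b : ℝ) * (k : ℝ) ^ 2 / (p : ℝ)))))

/-- By `ofReal_cot_sub_cot` each factor of the cotangent product is a factor of `sqDiffProd`, divided
by terms `1 - ζ ^ x`. Each nonzero `x` occurs `n - 1` times, which gives the denominator
`p ^ (n - 1)`. -/
theorem ofReal_cotDiffProd {n : ℕ} (hp : p = 2 * n + 1) {a b : ℤ}
    (hab : quadraticChar (ZMod p) ((a : ZMod p) * (b : ZMod p)) = -1) :
    (cotDiffProd p n a b : ℂ) =
      (-4) ^ (n * (n - 1) / 2) * sqDiffProd p n a b / (p : ℂ) ^ (n - 1) := by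
  have ha : (a : ZMod p) ≠ 0 := by intro h; simp [h] at hab
  have hb : (b : ZMod p) ≠ 0 := by intro h; simp [h] at hab
  have hne : ∀ j ∈ Icc 1 n, (j : ZMod p) ≠ 0 := fun j hj =>
    natCast_ne_zero_of_lt (mem_Icc.mp hj).1 (by have := (mem_Icc.mp hj).2; omega)
  -- Every index `j` lies in `n - 1` of the pairs.
  have hden : ∏ j ∈ Icc 1 n, ∏ k ∈ Ioc j n,
      ((1 - ZMod.stdAddChar ((a : ZMod p) * (j : ZMod p) ^ 2)) *
        (1 - ZMod.stdAddChar ((b : ZMod p) * (j : ZMod p) ^ 2))) *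
      ((1 - ZMod.stdAddChar ((a : ZMod p) * (k : ZMod p) ^ 2)) *
        (1 - ZMod.stdAddChar ((b : ZMod p) * (k : ZMod p) ^ 2))) = (p : ℂ) ^ (n - 1) := by
    rw [prod_triangle_symm n fun j _ => (1 - ZMod.stdAddChar ((a : ZMod p) * (j : ZMod p) ^ 2)) *
      (1 - ZMod.stdAddChar ((b : ZMod p) * (j : ZMod p) ^ 2))]
    have hcard : ∀ j ∈ Icc 1 n, #((Icc 1 n).erase j) = n - 1 := fun j hj => by
      rw [card_erase_of_mem hj, Nat.card_Icc, Nat.add_sub_cancel]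
    rw [Finset.prod_congr rfl fun j hj => by rw [Finset.prod_const, hcard j hj],
      Finset.prod_pow, Finset.prod_mul_distrib,
      prod_natCast_sq hp fun s => 1 - ZMod.stdAddChar ((a : ZMod p) * s),
      prod_natCast_sq hp fun s => 1 - ZMod.stdAddChar ((b : ZMod p) * s),
      prod_cosets_nonzeroSquares hab fun x => 1 - ZMod.stdAddChar x, prod_one_sub_stdAddChar]
  have hcot : ∀ c : ℤ, (c : ZMod p) ≠ 0 → ∀ j ∈ Icc 1 n, ∀ k ∈ Icc 1 n,
      ((Real.cot (Real.pi * ((c : ℝ) * (j : ℝ) ^ 2 / (p : ℝ))) -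
        Real.cot (Real.pi * ((c : ℝ) * (k : ℝ) ^ 2 / (p : ℝ))) : ℝ) : ℂ) =
      -2 * Complex.I * (ZMod.stdAddChar ((c : ZMod p) * (j : ZMod p) ^ 2) -
        ZMod.stdAddChar ((c : ZMod p) * (k : ZMod p) ^ 2)) /
        ((1 - ZMod.stdAddChar ((c : ZMod p) * (j : ZMod p) ^ 2)) *
          (1 - ZMod.stdAddChar ((c : ZMod p) * (k : ZMod p) ^ 2))) := by
    intro c hc j hj k hk
    have h := ofReal_cot_sub_cot (p := p) (z := c * (j : ℤ) ^ 2) (w := c * (k : ℤ) ^ 2)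
      (by push_cast; exact mul_ne_zero hc (pow_ne_zero _ (hne j hj)))
      (by push_cast; exact mul_ne_zero hc (pow_ne_zero _ (hne k hk)))
    simpa only [Int.cast_mul, Int.cast_pow, Int.cast_natCast] using h
  rw [← hden, ← prod_triangle_const n (-4 : ℂ), sqDiffProd, cotDiffProd, Complex.ofReal_prod]
  simp only [Complex.ofReal_prod, ← Finset.prod_mul_distrib, ← Finset.prod_div_distrib]
  refine Finset.prod_congr rfl fun j hj => Finset.prod_congr rfl fun k hk => ?_
  have hk' : k ∈ Icc 1 n := by
    rw [mem_Icc, mem_Ioc] at *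
    omega
  rw [Complex.ofReal_mul, hcot a ha j hj k hk', hcot b hb j hj k hk', div_mul_div_comm]
  congr 1
  · linear_combination 4 * (ZMod.stdAddChar ((a : ZMod p) * (j : ZMod p) ^ 2) -
        ZMod.stdAddChar ((a : ZMod p) * (k : ZMod p) ^ 2)) *
      (ZMod.stdAddChar ((b : ZMod p) * (j : ZMod p) ^ 2) -
        ZMod.stdAddChar ((b : ZMod p) * (k : ZMod p) ^ 2)) * Complex.I_sq
  · ring

end Cotangent

/-! ### The two evaluations -/

theorem rpow_quarter {x : ℝ} (hx : 0 < x) {p m : ℕ} (hp : p = 4 * m + 1) (hm : 0 < m) :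
    x ^ (((p : ℝ) - 3) / 4) = x ^ (m - 1) * Real.sqrt x := by
  rw [Real.sqrt_eq_rpow, ← Real.rpow_natCast, ← Real.rpow_add hx, Nat.cast_pred hm, hp]
  congr 1
  push_cast
  ring

theorem sunDelta_eq {p m : ℕ} (hp : p = 4 * m + 1) (a b : ℤ) :
    sunDelta (a * b) p =
      if ((a : ZMod p) * (b : ZMod p)) ^ m = ((2 * m).factorial : ZMod p) then 1 else -1 := by
  rw [sunDelta, show (p - 1) / 4 = m by omega, show (p - 1) / 2 = 2 * m by omega]
  refine if_congr ?_ rfl rfl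
  rw [← ZMod.intCast_eq_intCast_iff]
  push_cast
  rfl

theorem theorem3p2 (p : ℕ) [Fact p.Prime] (hp : p ≡ 1 [MOD 4]) (a b : ℤ)
    (hab : legendreSym p (a * b) = -1) (ζ : ℂ)
    (hζ : ζ = Complex.exp (2 * (Real.pi : ℂ) * Complex.I / (p : ℂ))) :
    (∏ j ∈ Finset.Icc 1 ((p - 1) / 2), ∏ k ∈ Finset.Ioc j ((p - 1) / 2),
        ((ζ ^ (a * (j : ℤ) ^ 2) - ζ ^ (a * (k : ℤ) ^ 2)) *
          (ζ ^ (b * (j : ℤ) ^ 2) - ζ ^ (b * (k : ℤ) ^ 2)))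
      = ((-(sunDelta (a * b) p : ℝ) * (p : ℝ) ^ (((p : ℝ) - 3) / 4) : ℝ) : ℂ)) ∧
    (∏ j ∈ Finset.Icc 1 ((p - 1) / 2), ∏ k ∈ Finset.Ioc j ((p - 1) / 2),
        ((Real.cot (Real.pi * ((a : ℝ) * (j : ℝ) ^ 2 / (p : ℝ))) -
            Real.cot (Real.pi * ((a : ℝ) * (k : ℝ) ^ 2 / (p : ℝ)))) *
          (Real.cot (Real.pi * ((b : ℝ) * (j : ℝ) ^ 2 / (p : ℝ))) -
            Real.cot (Real.pi * ((b : ℝ) * (k : ℝ) ^ 2 / (p : ℝ)))))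
      = (sunDelta (a * b) p : ℝ) * (-1) ^ ((p + 3) / 4) *
          ((2 : ℝ) ^ (p - 1) / (p : ℝ)) ^ (((p : ℝ) - 3) / 4)) := by
  obtain ⟨m, hpm, hm⟩ : ∃ m, p = 4 * m + 1 ∧ 0 < m := by
    have h2 := (Fact.out : p.Prime).two_le
    have h1 : p % 4 = 1 := hp
    exact ⟨p / 4, by omega, by omega⟩
  have hab' : quadraticChar (ZMod p) ((a : ZMod p) * (b : ZMod p)) = -1 := by
    rw [legendreSym, Int.cast_mul] at hab
    exact hab
  have hp0 : (0 : ℝ) < p := Nat.cast_pos.mpr (NeZero.pos p)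
  have hQ : sqDiffProd p (2 * m) a b =
      ((-(sunDelta (a * b) p : ℝ) * ((p : ℝ) ^ (m - 1) * Real.sqrt p) : ℝ) : ℂ) := by
    rw [sqDiffProd_eq hpm hm hab', ← sunDelta_eq hpm]
    push_cast
    ring
  rw [show (p - 1) / 2 = 2 * m by omega]
  constructor
  · rw [rpow_quarter hp0 hpm hm, ← hQ, sqDiffProd]
    have hpow : ∀ z : ℤ, ζ ^ z = ZMod.stdAddChar (z : ZMod p) := by
      intro z
      rw [hζ, ← Complex.exp_int_mul, ZMod.stdAddChar_coe]
      congr 1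
      ring
    simp only [hpow, Int.cast_mul, Int.cast_pow, Int.cast_natCast]
  · change cotDiffProd p (2 * m) a b = _
    have hC := ofReal_cotDiffProd (p := p) (n := 2 * m) (by omega) hab'
    rw [hQ, two_mul_mul_pred_div_two] at hC
    have hR : cotDiffProd p (2 * m) a b = (-4) ^ (m * (2 * m - 1)) *
        (-(sunDelta (a * b) p : ℝ) * ((p : ℝ) ^ (m - 1) * Real.sqrt p)) /
          (p : ℝ) ^ (2 * m - 1) := by
      apply Complex.ofReal_injective
      rw [hC]
      push_cast
      rfl
    have hpsqrt : (p : ℝ) ^ (2 * m - 1) = ((p : ℝ) ^ (m - 1) * Real.sqrt p) ^ 2 := by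
      rw [mul_pow, Real.sq_sqrt hp0.le, ← pow_mul, ← pow_succ]
      congr 1
      omega
    have hsqrt : Real.sqrt ((2 : ℝ) ^ (p - 1)) = 2 ^ (2 * m) := by
      rw [show p - 1 = 2 * m * 2 by omega, pow_mul, Real.sqrt_sq (by positivity)]
    have hfour : (-4 : ℝ) ^ (m * (2 * m - 1)) =
        (-1) ^ m * (((2 : ℝ) ^ (p - 1)) ^ (m - 1) * 2 ^ (2 * m)) := by
      obtain ⟨c, rfl⟩ : ∃ c, m = c + 1 := ⟨m - 1, by omega⟩
      have hodd : Odd (2 * (c + 1) - 1) := ⟨c, by omega⟩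
      rw [show (-4 : ℝ) = -1 * 2 ^ 2 by norm_num, mul_pow, mul_comm (c + 1), pow_mul (-1 : ℝ),
        hodd.neg_one_pow, ← pow_mul, ← pow_mul, ← pow_add]
      congr 2
      rw [hpm, Nat.add_sub_cancel, Nat.add_sub_cancel, show 2 * (c + 1) - 1 = 2 * c + 1 by omega]
      ring
    rw [rpow_quarter (div_pos (by positivity) hp0) hpm hm, Real.sqrt_div (by positivity), hsqrt,
      hR, hpsqrt, hfour, show (p + 3) / 4 = m + 1 by omega, div_pow]
    have h1 : (p : ℝ) ^ (m - 1) ≠ 0 := by positivity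
    have h2 : Real.sqrt p ≠ 0 := by positivity
    field_simp
    ring
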